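/- Let $F$ be an arbitrary field, let $K$ be a finite field extension of the rational function field $F(t)$, and let $d$ be a non-negative integer that is not divisible by the characteristic of $K$ (in characteristic $0$ this means $d \neq 0$; so $d \geq 1$ in every case). Let $c \in K$ and $f(z) = z^d + c \in K[z]$. Write $f^n$ for the $n$-th iterate of $f$ under composition. If $c$ does not belong to the field of constants of $K$, that is, if $c$ is not algebraic over $F$, then $f$ is eventually stable over $K$: there are integers $N \geq 0$ and $t$ such that for every $n > N$ the polynomial $f^n$ is a product of exactly $t$ irreducible polynomials in $K[z]$, counted with multiplicity. -/

import Mathlib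

open Polynomial

/-- The `n`-th iterate `fⁿ = f ∘ f ∘ ⋯ ∘ f` (`n` copies of `f`) of a polynomial under composition,
with `f⁰ = X`. -/
noncomputable def polyIterate {K : Type*} [Field K] (f : K[X]) (n : ℕ) : K[X] :=
  (fun g : K[X] => f.comp g)^[n] X

/-- A polynomial `f` over a field `K` is eventually stable over `K` if there are `N` and `t` such
that for every `n > N` the iterate `fⁿ` is a product of exactly `t` irreducible polynomials in
`K[X]`, counted with multiplicity. -/
def EventuallyStable {K : Type*} [Field K] (f : K[X]) : Prop :=
  ∃ N t : ℕ, ∀ n : ℕ, N < n → ∃ s : Multiset K[X],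
    (∀ g ∈ s, Irreducible g) ∧ s.prod = polyIterate f n ∧ s.card = t

section Iterate

variable {K : Type*} [Field K]

/-! The number of irreducible factors of `fⁿ` never decreases with `n`, so eventual stability
amounts to a uniform bound on it. Since `c` is transcendental over `F`, the ring `F[c]` is a
polynomial ring in which `c` is prime, and for `d ≥ 2` every iterate with `n ≥ 1` is Eisenstein at
`c`, so every iterate is irreducible over `F(c)`. Transcendence degree one makes `K` finite over
`F(c)`, and an irreducible polynomial over `F(c)` acquires at most `[K : F(c)]` factors over `K`. -/

theorem polyIterate_zero (f : K[X]) : polyIterate f 0 = X := rfl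

theorem polyIterate_succ (f : K[X]) (n : ℕ) :
    polyIterate f (n + 1) = f.comp (polyIterate f n) :=
  Function.iterate_succ_apply' _ _ _

theorem polyIterate_succ' (f : K[X]) (n : ℕ) :
    polyIterate f (n + 1) = (polyIterate f n).comp f := by
  induction n with
  | zero => simp [polyIterate_succ, polyIterate_zero]
  | succ n ih => rw [polyIterate_succ, ih, ← comp_assoc, ← polyIterate_succ, ih]

theorem natDegree_polyIterate (f : K[X]) (n : ℕ) :
    (polyIterate f n).natDegree = f.natDegree ^ n := by
  induction n with
  | zero => simp [polyIterate_zero]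
  | succ n ih => rw [polyIterate_succ, natDegree_comp, ih, pow_succ']

theorem Polynomial.Monic.polyIterate {f : K[X]} (hf : f.Monic) (hd : f.natDegree ≠ 0) (n : ℕ) :
    (polyIterate f n).Monic := by
  induction n with
  | zero => exact monic_X
  | succ n ih =>
    rw [polyIterate_succ]
    exact hf.comp ih (by rw [natDegree_polyIterate]; exact pow_ne_zero _ hd)

end Iterate

section FactorCount

open UniqueFactorizationMonoid

variable {K : Type*} [Field K]

theorem card_le_card_normalizedFactors_prod [DecidableEq K] (s : Multiset K[X])
    (h : ∀ g ∈ s, g ≠ 0 ∧ ¬ IsUnit g) : s.card ≤ (normalizedFactors s.prod).card := by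
  induction s using Multiset.induction_on with
  | empty => simp
  | cons g s ih =>
    obtain ⟨h0, hu⟩ := h g (Multiset.mem_cons_self g s)
    have hs : ∀ g ∈ s, g ≠ 0 ∧ ¬ IsUnit g := fun g hg => h g (Multiset.mem_cons_of_mem hg)
    have hs0 : s.prod ≠ 0 := Multiset.prod_ne_zero fun h => (hs 0 h).1 rfl
    have hg : 0 < (normalizedFactors g).card := by
      obtain ⟨p, hp⟩ := exists_mem_normalizedFactors h0 hu
      exact Multiset.card_pos_iff_exists_mem.2 ⟨p, hp⟩
    rw [Multiset.prod_cons, normalizedFactors_mul h0 hs0, Multiset.card_cons, Multiset.card_add]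
    have := ih hs
    omega

theorem Polynomial.Monic.prod_normalizedFactors [DecidableEq K] {p : K[X]} (hp : p.Monic) :
    (normalizedFactors p).prod = p := by
  rw [prod_normalizedFactors_eq hp.ne_zero, hp.normalize_eq_self]

/-- Each irreducible factor of `p`, composed with `f`, stays nonconstant and so contributes at least
one irreducible factor. -/
theorem card_normalizedFactors_le_comp [DecidableEq K] {p f : K[X]} (hp : p.Monic)
    (hf : f.natDegree ≠ 0) :
    (normalizedFactors p).card ≤ (normalizedFactors (p.comp f)).card := by
  have h : ((normalizedFactors p).map fun g => g.comp f).prod = p.comp f := by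
    rw [← multiset_prod_comp, hp.prod_normalizedFactors]
  rw [← h]
  refine le_trans (by simp) (card_le_card_normalizedFactors_prod _ ?_)
  intro g hg
  obtain ⟨q, hq, rfl⟩ := Multiset.mem_map.1 hg
  have hq' : Irreducible q := irreducible_of_normalized_factor q hq
  have hdeg : (q.comp f).natDegree ≠ 0 := by
    rw [natDegree_comp]
    exact mul_ne_zero hq'.natDegree_pos.ne' hf
  exact ⟨fun h => hdeg (by simp [h]), fun h => hdeg (natDegree_eq_zero_of_isUnit h)⟩

theorem Monotone.exists_forall_ge_eq_of_le {u : ℕ → ℕ} (hu : Monotone u) {B : ℕ}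
    (hB : ∀ n, u n ≤ B) : ∃ N t, ∀ n, N ≤ n → u n = t := by
  have hbdd : BddAbove (Set.range u) := ⟨B, by rintro _ ⟨n, rfl⟩; exact hB n⟩
  obtain ⟨N, hN⟩ := Nat.sSup_mem (Set.range_nonempty u) hbdd
  exact ⟨N, u N, fun n hn => le_antisymm (hN ▸ le_csSup hbdd ⟨n, rfl⟩) (hu hn)⟩

theorem eventuallyStable_of_card_normalizedFactors_le [DecidableEq K] {f : K[X]} (hf : f.Monic)
    (hd : f.natDegree ≠ 0) {B : ℕ} (hB : ∀ n, (normalizedFactors (polyIterate f n)).card ≤ B) :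
    EventuallyStable f := by
  have hmono : Monotone fun n => (normalizedFactors (polyIterate f n)).card :=
    monotone_nat_of_le_succ fun n => by
      rw [polyIterate_succ']
      exact card_normalizedFactors_le_comp (hf.polyIterate hd n) hd
  obtain ⟨N, t, h⟩ := hmono.exists_forall_ge_eq_of_le hB
  exact ⟨N, t, fun n hn => ⟨normalizedFactors (polyIterate f n),
    fun g hg => irreducible_of_normalized_factor g hg,
    (hf.polyIterate hd n).prod_normalizedFactors, h n hn.le⟩⟩

end FactorCount

section BaseChange

open UniqueFactorizationMonoid

variable {k K : Type*} [Field k] [Field K] [Algebra k K] [FiniteDimensional k K]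

/-- `K[X]/(g)` has degree `[K : k] * deg g` over `k` and contains a root of `p`, whose degree over
`k` is `deg p`. -/
theorem Irreducible.natDegree_le_finrank_mul_natDegree {p : k[X]} (hp : Irreducible p) {g : K[X]}
    (hg : Irreducible g) (hdvd : g ∣ p.map (algebraMap k K)) :
    p.natDegree ≤ Module.finrank k K * g.natDegree := by
  have := Fact.mk hg
  have : FiniteDimensional K (AdjoinRoot g) := (AdjoinRoot.powerBasis hg.ne_zero).finite
  have : FiniteDimensional k (AdjoinRoot g) := FiniteDimensional.trans k K _
  have hroot : aeval (AdjoinRoot.root g) p = 0 := by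
    obtain ⟨q, hq⟩ := hdvd
    rw [← aeval_map_algebraMap K, hq]
    simp [AdjoinRoot.aeval_eq]
  have hmin := minpoly.natDegree_le (A := k) (AdjoinRoot.root g)
  rw [← minpoly.eq_of_irreducible hp hroot,
    natDegree_mul_C (inv_ne_zero (leadingCoeff_ne_zero.2 hp.ne_zero)),
    ← Module.finrank_mul_finrank k K, (AdjoinRoot.powerBasis hg.ne_zero).finrank,
    AdjoinRoot.powerBasis_dim] at hmin
  exact hmin

/-- The degrees of the factors sum to `deg p`, and each is at least `deg p / [K : k]`. -/
theorem Irreducible.card_normalizedFactors_map_le_finrank [DecidableEq K] {p : k[X]}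
    (hp : Irreducible p) (hm : p.Monic) :
    (normalizedFactors (p.map (algebraMap k K))).card ≤ Module.finrank k K := by
  have hm' := hm.map (algebraMap k K)
  have hsum : ((normalizedFactors (p.map (algebraMap k K))).map natDegree).sum = p.natDegree := by
    rw [← natDegree_multiset_prod _ (zero_notMem_normalizedFactors _), hm'.prod_normalizedFactors,
      natDegree_map]
  have h := Multiset.card_nsmul_le_sum (s := (normalizedFactors (p.map (algebraMap k K))).map
    fun g => Module.finrank k K * g.natDegree) (a := p.natDegree) fun x hx => by
      obtain ⟨g, hg, rfl⟩ := Multiset.mem_map.1 hx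
      exact hp.natDegree_le_finrank_mul_natDegree (irreducible_of_normalized_factor g hg)
        (dvd_of_mem_normalizedFactors hg)
  rw [Multiset.sum_map_mul_left, Multiset.card_map, hsum, smul_eq_mul] at h
  exact Nat.le_of_mul_le_mul_right h hp.natDegree_pos

end BaseChange

section Eisenstein

/-- The iterates of `X ^ d + π` with coefficients in a commutative ring. -/
noncomputable def unicriticalIterate {A : Type*} [CommRing A] (d : ℕ) (π : A) : ℕ → A[X]
  | 0 => X
  | n + 1 => unicriticalIterate d π n ^ d + C π

theorem map_unicriticalIterate {A B : Type*} [CommRing A] [CommRing B] (φ : A →+* B) (d : ℕ)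
    (π : A) (n : ℕ) :
    (unicriticalIterate d π n).map φ = unicriticalIterate d (φ π) n := by
  induction n with
  | zero => simp [unicriticalIterate]
  | succ n ih => simp [unicriticalIterate, ih]

theorem unicriticalIterate_eq_polyIterate {K : Type*} [Field K] (d : ℕ) (c : K) (n : ℕ) :
    unicriticalIterate d c n = polyIterate (X ^ d + C c) n := by
  induction n with
  | zero => rfl
  | succ n ih => simp [unicriticalIterate, polyIterate_succ, ih]

theorem unicriticalIterate_zero_right {A : Type*} [CommRing A] (d n : ℕ) :
    unicriticalIterate d (0 : A) n = X ^ d ^ n := by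
  induction n with
  | zero => simp [unicriticalIterate]
  | succ n ih => simp [unicriticalIterate, ih, ← pow_mul, pow_succ]

variable {A : Type*} [CommRing A]

theorem monic_unicriticalIterate_and_natDegree [IsDomain A] {d : ℕ} (hd : d ≠ 0) (π : A) (n : ℕ) :
    (unicriticalIterate d π n).Monic ∧ (unicriticalIterate d π n).natDegree = d ^ n := by
  induction n with
  | zero => simp [unicriticalIterate, monic_X]
  | succ n ih =>
    have hdeg : (unicriticalIterate d π n ^ d).natDegree = d ^ (n + 1) := by
      rw [ih.1.natDegree_pow, ih.2, pow_succ']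
    have hpos : 0 < (unicriticalIterate d π n ^ d).natDegree := by
      rw [hdeg]; exact pow_pos (Nat.pos_of_ne_zero hd) _
    refine ⟨(ih.1.pow d).add_of_left ?_, ?_⟩
    · exact degree_C_le.trans_lt (natDegree_pos_iff_degree_pos.1 hpos)
    · rw [unicriticalIterate, natDegree_add_C, hdeg]

/-- Constant terms satisfy `aₙ₊₁ = aₙ ^ d + π` with `π ∣ aₙ`; `d ≥ 2` then makes `aₙ ^ d` vanish
modulo `π ^ 2`. -/
theorem sq_dvd_coeff_zero_unicriticalIterate_sub {d : ℕ} (hd : 2 ≤ d) (π : A) (n : ℕ) :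
    π ^ 2 ∣ (unicriticalIterate d π (n + 1)).coeff 0 - π := by
  have hdvd : ∀ n, π ∣ (unicriticalIterate d π n).coeff 0 := by
    intro n
    induction n with
    | zero => simp [unicriticalIterate]
    | succ n ih =>
      rw [unicriticalIterate, coeff_add, coeff_C_zero, coeff_zero_eq_eval_zero, eval_pow,
        ← coeff_zero_eq_eval_zero]
      exact dvd_add (dvd_pow ih (by omega)) dvd_rfl
  rw [unicriticalIterate, coeff_add, coeff_C_zero, add_sub_cancel_right, coeff_zero_eq_eval_zero,
    eval_pow, ← coeff_zero_eq_eval_zero]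
  exact (pow_dvd_pow π hd).trans (pow_dvd_pow_of_dvd (hdvd n) d)

theorem irreducible_unicriticalIterate [IsDomain A] {d : ℕ} (hd : 2 ≤ d) {π : A} (hπ : Prime π) (n : ℕ) :
    Irreducible (unicriticalIterate d π n) := by
  cases n with
  | zero => exact irreducible_X
  | succ n =>
    obtain ⟨hmonic, hdeg⟩ :=
      monic_unicriticalIterate_and_natDegree (by omega : d ≠ 0) π (n + 1)
    have hprime : (Ideal.span {π}).IsPrime := (Ideal.span_singleton_prime hπ.ne_zero).2 hπ
    refine IsEisensteinAt.irreducible (𝓟 := Ideal.span {π}) ⟨?_, ?_, ?_⟩ hprime hmonic.isPrimitive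
      (by rw [hdeg]; positivity)
    · rw [hmonic.leadingCoeff]
      exact fun h => hprime.ne_top ((Ideal.eq_top_iff_one _).2 h)
    · intro i hi
      rw [← Ideal.Quotient.eq_zero_iff_mem, ← coeff_map, map_unicriticalIterate,
        Ideal.Quotient.eq_zero_iff_mem.2 (Ideal.mem_span_singleton_self π),
        unicriticalIterate_zero_right, coeff_X_pow, if_neg (by omega)]
    · rw [Ideal.span_singleton_pow, Ideal.mem_span_singleton]
      intro h
      have h2 : π ^ 2 ∣ π := (dvd_sub_right h).1 (sq_dvd_coeff_zero_unicriticalIterate_sub hd π n)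
      rw [pow_two] at h2
      exact hπ.not_isUnit (isUnit_of_dvd_one
        ((mul_dvd_mul_iff_left hπ.ne_zero).1 (by rwa [mul_one])))

theorem eventuallyStable_of_prime [IsDomain A] [IsIntegrallyClosed A] (k : Type*) {K : Type*} [Field k]
    [Field K] [Algebra A k] [IsFractionRing A k] [Algebra k K] [FiniteDimensional k K] {d : ℕ}
    (hd : 2 ≤ d) {π : A} (hπ : Prime π) {c : K} (hc : algebraMap k K (algebraMap A k π) = c) :
    EventuallyStable (X ^ d + C c : K[X]) := by
  classical
  subst hc
  refine eventuallyStable_of_card_normalizedFactors_le (B := Module.finrank k K)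
    (monic_X_pow_add_C _ (by omega)) (by rw [natDegree_X_pow_add_C]; omega) fun n => ?_
  have hmonic := (monic_unicriticalIterate_and_natDegree (by omega : d ≠ 0) π n).1
  -- Gauss's lemma for monic polynomials over an integrally closed domain.
  have hirr := (hmonic.irreducible_iff_irreducible_map_fraction_map (K := k)).1
    (irreducible_unicriticalIterate hd hπ n)
  rw [← unicriticalIterate_eq_polyIterate, ← map_unicriticalIterate, ← map_unicriticalIterate]
  exact hirr.card_normalizedFactors_map_le_finrank (hmonic.map _)

end Eisenstein

section FunctionField

open IntermediateField

variable {F K : Type*} [Field F] [Field K] [Algebra F K]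

theorem trdeg_eq_one_of_finiteDimensional_ratFunc [Algebra (RatFunc F) K]
    [IsScalarTower F (RatFunc F) K] [FiniteDimensional (RatFunc F) K] :
    Algebra.trdeg F K = 1 := by
  have h1 := lift_trdeg_add_eq F F[X] (RatFunc F)
  have : Algebra.IsAlgebraic F[X] (RatFunc F) := IsLocalization.isAlgebraic _ (nonZeroDivisors F[X])
  rw [Polynomial.trdeg_of_isDomain, trdeg_eq_zero (R := F[X])] at h1
  have h2 := lift_trdeg_add_eq F (RatFunc F) K
  rw [trdeg_eq_zero (R := RatFunc F) (A := K)] at h2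
  simp at h1 h2
  simpa [← h1] using h2.symm

/-- In transcendence degree one, `c` alone is a transcendence basis, so `K` is algebraic and
finitely generated over `F(c)`. -/
theorem finiteDimensional_adjoin_of_transcendental [Algebra.EssFiniteType F K]
    (h : Algebra.trdeg F K = 1) {c : K} (hc : Transcendental F c) :
    FiniteDimensional F⟮c⟯ K := by
  have hind : AlgebraicIndependent F (fun _ : Unit => c) :=
    (algebraicIndependent_unique_type_iff).2 hc
  have hbasis := hind.isTranscendenceBasis_of_lift_trdeg_le_of_finite (by simp [h])
  have halg := hbasis.isAlgebraic_field
  rw [Set.range_const] at halg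
  have : Algebra.EssFiniteType F⟮c⟯ K := .of_comp F _ _
  exact Algebra.finite_of_essFiniteType_of_isAlgebraic

-- The isomorphism `F[X] ≃ F[c]` sends `X` to `c`; it transports unique factorization, hence
-- integral closedness, and the primality of `X`.
open scoped IntermediateField.algebraAdjoinAdjoin in
theorem eventuallyStable_of_transcendental {d : ℕ} (hd : 2 ≤ d) {c : K}
    (hc : Transcendental F c) [FiniteDimensional F⟮c⟯ K] :
    EventuallyStable (X ^ d + C c : K[X]) := by
  let e := Polynomial.algEquivOfTranscendental F c hc
  have : UniqueFactorizationMonoid (Algebra.adjoin F {c}) :=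
    e.toMulEquiv.uniqueFactorizationMonoid inferInstance
  have hprime : Prime (⟨c, Algebra.self_mem_adjoin_singleton F c⟩ : Algebra.adjoin F {c}) := by
    rw [← Polynomial.algEquivOfTranscendental_apply_X F c hc]
    exact (MulEquiv.prime_iff e.toMulEquiv).2 prime_X
  exact eventuallyStable_of_prime F⟮c⟯ hd hprime rfl

end FunctionField

theorem eventuallyStable_of_natDegree_eq_one {K : Type*} [Field K] {f : K[X]}
    (hf : f.natDegree = 1) : EventuallyStable f :=
  ⟨0, 1, fun n _ => ⟨{polyIterate f n}, fun g hg => by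
    rw [Multiset.mem_singleton.1 hg]
    exact irreducible_of_degree_eq_one
      ((degree_eq_iff_natDegree_eq_of_pos one_pos).2 (by rw [natDegree_polyIterate, hf, one_pow])),
    by simp, by simp⟩⟩

theorem corollary1p7 {F K : Type*} [Field F] [Field K] [Algebra F K] [Algebra (RatFunc F) K]
    [IsScalarTower F (RatFunc F) K] (hK : FiniteDimensional (RatFunc F) K)
    (d : ℕ) (hd : ¬ ringChar K ∣ d) (c : K) (hc : c ∉ algebraicClosure F K) :
    EventuallyStable (X ^ d + C c : K[X]) := by
  have hd0 : d ≠ 0 := fun h => hd (h ▸ dvd_zero _)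
  have hc' : Transcendental F c := fun h => hc (mem_algebraicClosure_iff.2 h)
  -- The Eisenstein argument needs `d ≥ 2`; for `d = 1` all iterates are linear.
  obtain rfl | hd2 : d = 1 ∨ 2 ≤ d := by omega
  · exact eventuallyStable_of_natDegree_eq_one (natDegree_X_pow_add_C)
  · have : Algebra.EssFiniteType F[X] (RatFunc F) := .of_isLocalization _ (nonZeroDivisors F[X])
    have : Algebra.EssFiniteType F (RatFunc F) := .comp F F[X] _
    have : Algebra.EssFiniteType F K := .comp F (RatFunc F) K
    have := finiteDimensional_adjoin_of_transcendental
      trdeg_eq_one_of_finiteDimensional_ratFunc hc'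
    exact eventuallyStable_of_transcendental hd2 hc'
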